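/- Let $d>0$ be fixed. For each $n\ge 1$ let $\boldsymbol A$ be a random $n\times n$ matrix over $\mathbb F_2$ whose entries are independent and each equal to $1$ with probability $\min(d/n,1)$ and to $0$ otherwise. Let $$f(\boldsymbol A)=\frac1n\,\bigl|\{i\in\{1,\dots,n\}:\ x_i=0\text{ for all }x\in\ker\boldsymbol A\}\bigr|$$ be the fraction of frozen coordinates. Given $\boldsymbol A$, let $\boldsymbol x,\boldsymbol x'$ be independent and uniformly distributed on $\ker\boldsymbol A=\{x\in\mathbb F_2^n:\boldsymbol Ax=0\}$, and let $$R(\boldsymbol x,\boldsymbol x')=\frac1n\sum_{i=1}^n \mathbf 1\{\boldsymbol x_i=\boldsymbol x'_i\}$$ be their overlap. Then $$\lim_{n\to\infty}\mathbb E\left|R(\boldsymbol x,\boldsymbol x')-\frac{1+f(\boldsymbol A)}2\right|=0,$$ where the expectation is over $\boldsymbol A$, $\boldsymbol x$ and $\boldsymbol x'$ jointly. -/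

import Mathlib

open scoped BigOperators NNReal ENNReal

noncomputable section

namespace SparseParity

/-- The probability `(d / n) ∧ 1` with which an entry of the random matrix equals one. -/
def entryProb (d : ℝ) (n : ℕ) : ℝ≥0 := min (Real.toNNReal (d / n)) 1

/-- The probability that a single entry takes the value `b` when it equals one with
probability `p`. -/
def entryWeight (p : ℝ≥0) (b : ZMod 2) : ℝ≥0∞ :=
  if b = 1 then (p : ℝ≥0∞) else ((1 - p : ℝ≥0) : ℝ≥0∞)

theorem sum_entryWeight {p : ℝ≥0} (hp : p ≤ 1) : ∑ b : ZMod 2, entryWeight p b = 1 := by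
  have h : (Finset.univ : Finset (ZMod 2)) = {0, 1} := by decide
  rw [h, Finset.sum_pair (by decide)]
  simp only [entryWeight, if_true, if_neg (show ¬ (0 : ZMod 2) = 1 by decide)]
  rw [← ENNReal.coe_add, tsub_add_cancel_of_le hp, ENNReal.coe_one]

theorem sum_prod_entryWeight {p : ℝ≥0} (hp : p ≤ 1) (n : ℕ) :
    ∑ A : Matrix (Fin n) (Fin n) (ZMod 2), ∏ i, ∏ j, entryWeight p (A i j) = 1 := by
  have h1 : ∑ v : Fin n → ZMod 2, ∏ j, entryWeight p (v j) = 1 := by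
    have h := Finset.prod_univ_sum (fun _ : Fin n => (Finset.univ : Finset (ZMod 2)))
      (fun _ b => entryWeight p b)
    rw [Fintype.piFinset_univ] at h
    rw [← h]
    simp [sum_entryWeight hp]
  have h := Finset.prod_univ_sum (fun _ : Fin n => (Finset.univ : Finset (Fin n → ZMod 2)))
    (fun _ v => ∏ j, entryWeight p (v j))
  rw [Fintype.piFinset_univ] at h
  refine Eq.trans h.symm ?_
  simp [h1]

/-- The law of the random `n × n` matrix over `𝔽₂` whose entries are independent and equal one
with probability `(d / n) ∧ 1`. -/
def matrixLaw (d : ℝ) (n : ℕ) : PMF (Matrix (Fin n) (Fin n) (ZMod 2)) :=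
  PMF.ofFintype (fun A => ∏ i, ∏ j, entryWeight (entryProb d n) (A i j))
    (sum_prod_entryWeight (min_le_right _ _) n)

/-- The kernel of `A`, a subspace of `𝔽₂ⁿ`. -/
abbrev kernel {n : ℕ} (A : Matrix (Fin n) (Fin n) (ZMod 2)) :
    Submodule (ZMod 2) (Fin n → ZMod 2) :=
  LinearMap.ker A.mulVecLin

open Classical in
/-- The uniform distribution on the kernel of `A`, as a distribution on `𝔽₂ⁿ`. -/
def uniformKernel {n : ℕ} (A : Matrix (Fin n) (Fin n) (ZMod 2)) : PMF (Fin n → ZMod 2) :=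
  (PMF.uniformOfFintype (kernel A)).map Subtype.val

/-- The joint law of `(A, x, x')`: the matrix `A` has law `matrixLaw d n` and, given `A`, the
vectors `x` and `x'` are independent and uniformly distributed on the kernel of `A`. -/
def jointLaw (d : ℝ) (n : ℕ) :
    PMF (Matrix (Fin n) (Fin n) (ZMod 2) × (Fin n → ZMod 2) × (Fin n → ZMod 2)) :=
  (matrixLaw d n).bind fun A =>
    (uniformKernel A).bind fun x =>
      (uniformKernel A).bind fun x' => PMF.pure (A, x, x')

/-- The expectation of a real random variable on a finite probability space. -/
def expectation {Ω : Type*} [Fintype Ω] (μ : PMF Ω) (X : Ω → ℝ) : ℝ :=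
  ∑ ω, (μ ω).toReal * X ω

/-- The fraction `f(A)` of frozen coordinates, i.e. of those `i` with `x i = 0` for all `x` in
the kernel of `A`. -/
def frozenFraction {n : ℕ} (A : Matrix (Fin n) (Fin n) (ZMod 2)) : ℝ :=
  ({i : Fin n | ∀ x ∈ kernel A, x i = 0}.ncard : ℝ) / n

/-- The overlap `R(x, x')`, the fraction of coordinates in which `x` and `x'` agree. -/
def overlap {n : ℕ} (x x' : Fin n → ZMod 2) : ℝ :=
  (∑ i : Fin n, if x i = x' i then (1 : ℝ) else 0) / n

end SparseParity

end

/-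
Given `A`, the difference of two uniform kernel elements is again uniform on the kernel, and the
characters of `𝔽₂` express the conditional variance of its number of zeros by the number of locked
pairs: pairs of unfrozen coordinates which agree on the whole kernel. It thus suffices that locked
pairs have vanishing density in expectation.

If a row of `A` is zero, replacing it by the `j`-th unit vector pins the coordinate `j`, which
freezes precisely the coordinates locked to `j`. Averaged over `j`, this raises the frozen fraction
by the density of locked pairs. But the law of `A` barely changes when a random row is replaced by
zero, nor when it is replaced by a random unit vector: rows of either kind occur a number of times
that tends to infinity and concentrates about its mean. Hence the mean frozen fraction cannot move
by a positive amount.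
-/

namespace SparseParity

section Resampling

open MeasureTheory ProbabilityTheory

theorem integral_abs_le_sqrt_integral_sq {Ω : Type*} [MeasurableSpace Ω] {P : Measure Ω}
    [IsProbabilityMeasure P] {X : Ω → ℝ} (hX : MemLp X 2 P) :
    ∫ ω, |X ω| ∂P ≤ √(∫ ω, X ω ^ 2 ∂P) := by
  refine Real.le_sqrt_of_sq_le ?_
  have hvar := (variance_nonneg |X| P).trans_eq (variance_eq_sub hX.abs)
  simpa using hvar

theorem measurePreserving_update {ι : Type*} [Fintype ι] [DecidableEq ι] {α : ι → Type*}
    [∀ i, MeasurableSpace (α i)] (μ : ∀ i, Measure (α i)) [∀ i, IsProbabilityMeasure (μ i)]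
    (r : ι) :
    MeasurePreserving (fun z : (∀ i, α i) × α r => Function.update z.1 r z.2)
      ((Measure.pi μ).prod (μ r)) (Measure.pi μ) := by
  refine ⟨measurable_update', (Measure.pi_eq fun s hs => ?_).symm⟩
  have hpre : (fun z : (∀ i, α i) × α r => Function.update z.1 r z.2) ⁻¹' Set.univ.pi s =
      Set.univ.pi (Function.update s r Set.univ) ×ˢ s r := by
    ext ⟨A, v⟩
    simp only [Set.mem_preimage, Set.mem_univ_pi, Set.mem_prod]
    rw [Function.forall_update_iff A (fun i a => a ∈ s i),
      Function.forall_update_iff s (fun i t => A i ∈ t)]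
    simp [and_comm]
  rw [Measure.map_apply measurable_update' (.univ_pi hs), hpre, Measure.prod_prod, Measure.pi_pi,
    Fintype.prod_eq_mul_prod_compl r, Fintype.prod_eq_mul_prod_compl r, Function.update_self,
    measure_univ, one_mul, mul_comm]
  congr 1
  exact Finset.prod_congr rfl fun i hi => by rw [Function.update_of_ne (by simpa using hi)]

theorem integral_integral_update {ι : Type*} [Fintype ι] [DecidableEq ι] {α : ι → Type*}
    [∀ i, MeasurableSpace (α i)] (μ : ∀ i, Measure (α i)) [∀ i, IsProbabilityMeasure (μ i)]
    (r : ι) {F : (∀ i, α i) → ℝ} (hF : Integrable F (Measure.pi μ)) :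
    ∫ A, ∫ v, F (Function.update A r v) ∂μ r ∂Measure.pi μ = ∫ A, F A ∂Measure.pi μ := by
  have hupd := measurePreserving_update μ r
  calc _ = ∫ z : (∀ i, α i) × α r, F (Function.update z.1 r z.2) ∂(Measure.pi μ).prod (μ r) :=
        (integral_prod _ (hupd.integrable_comp_of_integrable hF)).symm
    _ = ∫ A, F A ∂((Measure.pi μ).prod (μ r)).map fun z => Function.update z.1 r z.2 :=
        (integral_map hupd.aemeasurable
          (hupd.map_eq.symm ▸ hF.aestronglyMeasurable : AEStronglyMeasurable F _)).symm
    _ = ∫ A, F A ∂Measure.pi μ := by rw [hupd.map_eq]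

theorem integral_cond {α : Type*} [MeasurableSpace α] (μ : Measure α) (S : Set α) (g : α → ℝ) :
    ∫ v, g v ∂μ[|S] = (∫ v in S, g v ∂μ) / μ.real S := by
  rw [ProbabilityTheory.cond, integral_smul_measure, ENNReal.toReal_inv, smul_eq_mul,
    ← measureReal_def, inv_mul_eq_div]

section Range

variable {α κ : Type*} [MeasurableSpace α] [MeasurableSingletonClass α] [Fintype κ]
  (μ : Measure α) [IsFiniteMeasure μ] {f : κ → α} {p : ℝ}

theorem measureReal_range_of_injective (hf : Function.Injective f)
    (hμ : ∀ k, μ.real {f k} = p) : μ.real (Set.range f) = Fintype.card κ * p := by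
  have hrange : Set.range f = Finset.univ.map ⟨f, hf⟩ := by simp
  rw [hrange, ← sum_measureReal_singleton]
  simp only [Finset.sum_map, Function.Embedding.coeFn_mk, hμ, Finset.sum_const, Finset.card_univ,
    nsmul_eq_mul]

theorem integral_cond_range (hf : Function.Injective f) (hp : p ≠ 0)
    (hμ : ∀ k, μ.real {f k} = p) (g : α → ℝ) :
    ∫ v, g v ∂μ[|Set.range f] = (∑ k, g (f k)) / Fintype.card κ := by
  have hint : ∫ v in Set.range f, g v ∂μ = p * ∑ k, g (f k) := by
    have hrange : Set.range f = Finset.univ.map ⟨f, hf⟩ := by simp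
    rw [hrange, setIntegral_finset _ .finset]
    simp [hμ, Finset.mul_sum]
  rw [integral_cond, measureReal_range_of_injective μ hf hμ, hint, mul_comm (Fintype.card κ : ℝ),
    mul_div_mul_left _ _ hp]

end Range

variable {ι α : Type*} [Fintype ι]

/-- The number of coordinates of `A` that lie in `S`, as a real random variable. -/
noncomputable def occupation (S : Set α) (A : ι → α) : ℝ := ∑ r, S.indicator 1 (A r)

variable [MeasurableSpace α] (μ : Measure α) [IsProbabilityMeasure μ] {S : Set α}

theorem memLp_indicator_eval (hS : MeasurableSet S) (r : ι) :
    MemLp (fun A : ι → α => S.indicator (1 : α → ℝ) (A r)) 2 (Measure.pi fun _ => μ) :=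
  ((memLp_const (1 : ℝ)).indicator hS).comp_measurePreserving
    (measurePreserving_eval (fun _ => μ) r)

theorem memLp_occupation (hS : MeasurableSet S) :
    MemLp (occupation S : (ι → α) → ℝ) 2 (Measure.pi fun _ => μ) :=
  memLp_finsetSum _ fun r _ => memLp_indicator_eval μ hS r

theorem integral_occupation (hS : MeasurableSet S) :
    ∫ A : ι → α, occupation S A ∂Measure.pi (fun _ => μ) = Fintype.card ι * μ.real S := by
  have hcoord (r : ι) :
      ∫ A : ι → α, S.indicator (1 : α → ℝ) (A r) ∂Measure.pi (fun _ => μ) = μ.real S :=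
    (integral_comp_eval (μ := fun _ => μ) (stronglyMeasurable_one.indicator
      hS).aestronglyMeasurable).trans (integral_indicator_one hS)
  simp only [occupation]
  rw [integral_finsetSum _ fun r _ => (memLp_indicator_eval μ hS r).integrable one_le_two]
  simp [hcoord]

theorem variance_occupation_le (hS : MeasurableSet S) :
    Var[(occupation S : (ι → α) → ℝ); Measure.pi fun _ => μ] ≤ Fintype.card ι * μ.real S := by
  have hmem : MemLp (S.indicator (1 : α → ℝ)) 2 μ := (memLp_const 1).indicator hS
  have hvar : Var[S.indicator (1 : α → ℝ); μ] ≤ μ.real S := by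
    refine (variance_le_expectation_sq hmem.aestronglyMeasurable).trans_eq ?_
    rw [← integral_indicator_one hS]
    congr 1 with v
    by_cases hv : v ∈ S <;> simp [hv]
  calc _ = ∑ _r : ι, Var[S.indicator (1 : α → ℝ); μ] := by
        rw [← variance_sum_pi fun _ => hmem]
        congr 1
        ext A
        simp [occupation]
    _ ≤ ∑ _r : ι, μ.real S := Finset.sum_le_sum fun _ _ => hvar
    _ = Fintype.card ι * μ.real S := by simp

theorem integral_abs_occupation_sub_le (hS : MeasurableSet S) :
    ∫ A : ι → α, |occupation S A - Fintype.card ι * μ.real S| ∂Measure.pi (fun _ => μ) ≤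
      √(Fintype.card ι * μ.real S) := by
  have hmem := memLp_occupation (ι := ι) μ hS
  refine (integral_abs_le_sqrt_integral_sq (hmem.sub (memLp_const _))).trans
    (Real.sqrt_le_sqrt ((variance_occupation_le μ hS).trans' (le_of_eq ?_)))
  rw [variance_eq_integral hmem.aemeasurable, integral_occupation μ hS]
  rfl

theorem abs_integral_occupation_sub_mul_le (hS : MeasurableSet S) {G : (ι → α) → ℝ} {C : ℝ}
    (hG : ∀ A, |G A| ≤ C) :
    |∫ A, (occupation S A - Fintype.card ι * μ.real S) * G A ∂Measure.pi (fun _ => μ)| ≤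
      √(Fintype.card ι * μ.real S) * C := by
  obtain ⟨A₀⟩ := nonempty_of_isProbabilityMeasure (Measure.pi fun _ : ι => μ)
  have hC : 0 ≤ C := (abs_nonneg _).trans (hG A₀)
  have hdev := ((memLp_occupation (ι := ι) μ hS).sub
    (memLp_const (Fintype.card ι * μ.real S))).integrable one_le_two
  have hbound (A : ι → α) : ‖(occupation S A - Fintype.card ι * μ.real S) * G A‖ ≤
      |occupation S A - Fintype.card ι * μ.real S| * C := by
    rw [norm_mul]
    exact mul_le_mul_of_nonneg_left (hG A) (norm_nonneg _)
  calc _ ≤ ∫ A : ι → α, |occupation S A - Fintype.card ι * μ.real S| * C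
        ∂Measure.pi (fun _ => μ) :=
        norm_integral_le_of_norm_le (hdev.abs.mul_const C) (ae_of_all _ hbound)
    _ ≤ √(Fintype.card ι * μ.real S) * C := by
        rw [integral_mul_const]
        gcongr
        exact integral_abs_occupation_sub_le μ hS

variable [DecidableEq ι]

theorem integral_indicator_eval_mul (hS : MeasurableSet S) (hS0 : μ.real S ≠ 0)
    {G : (ι → α) → ℝ} (hG : Integrable G (Measure.pi fun _ => μ)) (r : ι) :
    ∫ A, S.indicator 1 (A r) * G A ∂Measure.pi (fun _ => μ) =
      μ.real S * ∫ A, ∫ v, G (Function.update A r v) ∂μ[|S] ∂Measure.pi (fun _ => μ) := by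
  have hint : Integrable (fun A : ι → α => S.indicator 1 (A r) * G A)
      (Measure.pi fun _ => μ) := by
    refine (hG.indicator (measurable_pi_apply r hS)).congr (ae_of_all _ fun A => ?_)
    by_cases hA : A r ∈ S <;> simp [hA]
  rw [← integral_integral_update (fun _ => μ) r hint, ← integral_const_mul]
  congr 1 with A
  rw [integral_cond, mul_div_cancel₀ _ hS0, ← integral_indicator hS]
  congr 1 with v
  by_cases hv : v ∈ S <;> simp [hv]

theorem integral_occupation_mul (hS : MeasurableSet S) (hS0 : μ.real S ≠ 0)
    {G : (ι → α) → ℝ} (hGm : Measurable G) {C : ℝ} (hG : ∀ A, |G A| ≤ C) :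
    ∫ A, occupation S A * G A ∂Measure.pi (fun _ => μ) =
      μ.real S * ∑ r, ∫ A, ∫ v, G (Function.update A r v) ∂μ[|S] ∂Measure.pi (fun _ => μ) := by
  have hGint : Integrable G (Measure.pi fun _ => μ) :=
    .of_bound hGm.aestronglyMeasurable C (ae_of_all _ hG)
  simp only [occupation, Finset.sum_mul]
  rw [integral_finsetSum _ fun r _ => ((memLp_indicator_eval μ hS r).integrable
    one_le_two).mul_bdd hGm.aestronglyMeasurable (ae_of_all _ hG), Finset.mul_sum]
  exact Finset.sum_congr rfl fun r _ => integral_indicator_eval_mul μ hS hS0 hGint r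

/- Resampling a uniformly chosen coordinate conditionally on `S` reweights the law by the ratio of
`occupation S` to its mean, and this ratio concentrates at one. -/
theorem abs_integral_sub_average_cond_le [Nonempty ι] (hS : MeasurableSet S)
    (hS0 : 0 < μ.real S) {G : (ι → α) → ℝ} (hGm : Measurable G) {C : ℝ} (hG : ∀ A, |G A| ≤ C) :
    |∫ A, G A ∂Measure.pi (fun _ => μ) -
        (∑ r, ∫ A, ∫ v, G (Function.update A r v) ∂μ[|S] ∂Measure.pi (fun _ => μ)) /
          Fintype.card ι| ≤ C / √(Fintype.card ι * μ.real S) := by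
  have hn : (0 : ℝ) < Fintype.card ι := by exact_mod_cast Fintype.card_pos
  have hdev := abs_integral_occupation_sub_mul_le (ι := ι) μ hS hG
  have havg := integral_occupation_mul (ι := ι) μ hS hS0.ne' hGm hG
  set P : Measure (ι → α) := Measure.pi fun _ => μ
  set m := Fintype.card ι * μ.real S with hm
  have hm0 : 0 < m := mul_pos hn hS0
  have hGint : Integrable G P := .of_bound hGm.aestronglyMeasurable C (ae_of_all _ hG)
  have hNG : Integrable (fun A => occupation S A * G A) P :=
    ((memLp_occupation μ hS).integrable one_le_two).mul_bdd hGm.aestronglyMeasurable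
      (ae_of_all _ hG)
  have hsplit : ∫ A, (occupation S A - m) * G A ∂P =
      ∫ A, occupation S A * G A ∂P - m * ∫ A, G A ∂P := by
    simp only [sub_mul]
    rw [integral_sub hNG (hGint.const_mul m), integral_const_mul]
  have hquot : (∑ r, ∫ A, ∫ v, G (Function.update A r v) ∂μ[|S] ∂P) / Fintype.card ι =
      (∫ A, occupation S A * G A ∂P) / m := by
    rw [havg, hm, mul_comm (Fintype.card ι : ℝ), mul_div_mul_left _ _ hS0.ne']
  calc _ = |∫ A, (occupation S A - m) * G A ∂P| / m := by
        rw [hquot, hsplit, abs_sub_comm, ← abs_of_pos hm0, ← abs_div, abs_of_pos hm0, sub_div,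
          mul_div_cancel_left₀ _ hm0.ne']
    _ ≤ √m * C / m := by gcongr
    _ = C / √m := by rw [mul_comm, mul_div_assoc, Real.sqrt_div_self', mul_one_div]

variable [MeasurableSingletonClass α] {κ : Type*} [Fintype κ] {f : κ → α} {p : ℝ}

theorem abs_integral_sub_average_update_range_le [Nonempty ι] [Nonempty κ]
    (hf : Function.Injective f) (hp : 0 < p) (hμ : ∀ k, μ.real {f k} = p) {G : (ι → α) → ℝ}
    (hGm : Measurable G) {C : ℝ} (hG : ∀ A, |G A| ≤ C) :
    |∫ A, G A ∂Measure.pi (fun _ => μ) -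
        (∑ r, ∫ A, (∑ k, G (Function.update A r (f k))) / Fintype.card κ
          ∂Measure.pi (fun _ => μ)) / Fintype.card ι| ≤
      C / √(Fintype.card ι * (Fintype.card κ * p)) := by
  have hmeas := measureReal_range_of_injective μ hf hμ
  have hpos : 0 < μ.real (Set.range f) := hmeas ▸ by positivity
  have hS : MeasurableSet (Set.range f) := (Set.finite_range f).measurableSet
  simpa only [integral_cond_range μ hf hp.ne' hμ, hmeas] using
    abs_integral_sub_average_cond_le μ hS hpos hGm hG

theorem abs_integral_sub_average_update_le [Nonempty ι] {v : α} (hp : 0 < μ.real {v})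
    {G : (ι → α) → ℝ} (hGm : Measurable G) {C : ℝ} (hG : ∀ A, |G A| ≤ C) :
    |∫ A, G A ∂Measure.pi (fun _ => μ) -
        (∑ r, ∫ A, G (Function.update A r v) ∂Measure.pi (fun _ => μ)) / Fintype.card ι| ≤
      C / √(Fintype.card ι * μ.real {v}) := by
  simpa only [Finset.univ_unique, Finset.sum_singleton, Fintype.card_unique, Nat.cast_one,
    div_one, one_mul] using abs_integral_sub_average_update_range_le μ
      (Function.injective_of_subsingleton fun _ : Unit => v) hp (fun _ => rfl) hGm hG

end Resampling

section LockedPairs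

variable {R κ : Type*} [Ring R] {K : Submodule R (κ → R)} {i j : κ}

/-- The submodule obtained from `K` by pinning the coordinate `j` to zero. -/
def pinned (K : Submodule R (κ → R)) (j : κ) : Submodule R (κ → R) :=
  K ⊓ LinearMap.ker (LinearMap.proj j : (κ → R) →ₗ[R] R)

theorem mem_pinned {x : κ → R} : x ∈ pinned K j ↔ x ∈ K ∧ x j = 0 := by simp [pinned]

variable [Fintype κ]

open Classical in
/-- The coordinates frozen by `K`, i.e. those at which every element of `K` vanishes. -/
noncomputable def frozenSet (K : Submodule R (κ → R)) : Finset κ := {i | ∀ x ∈ K, x i = 0}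

open Classical in
/-- The ordered pairs of unfrozen coordinates that agree throughout `K`, the diagonal included.
They carry the variance of the number of zeros of a random element of `K`. -/
noncomputable def lockedPairs (K : Submodule R (κ → R)) : Finset (κ × κ) :=
  {p | p.1 ∉ frozenSet K ∧ ∀ x ∈ K, x p.1 = x p.2}

theorem mem_frozenSet : i ∈ frozenSet K ↔ ∀ x ∈ K, x i = 0 := by simp [frozenSet]

theorem mem_lockedPairs :
    (i, j) ∈ lockedPairs K ↔ i ∉ frozenSet K ∧ ∀ x ∈ K, x i = x j := by simp [lockedPairs]

theorem snd_notMem_frozenSet_of_mem_lockedPairs (h : (i, j) ∈ lockedPairs K) :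
    j ∉ frozenSet K := by
  rw [mem_lockedPairs, mem_frozenSet] at h
  exact fun hj => h.1 fun x hx => (h.2 x hx).trans (mem_frozenSet.1 hj x hx)

end LockedPairs

section Density

variable {R κ : Type*} [Ring R] [Fintype κ] (K : Submodule R (κ → R))

/-- The fraction of coordinates frozen by `K`. -/
noncomputable def frozenDensity : ℝ := (frozenSet K).card / Fintype.card κ

/-- The fraction of pairs of coordinates locked by `K`. -/
noncomputable def lockedDensity : ℝ := (lockedPairs K).card / (Fintype.card κ : ℝ) ^ 2

theorem abs_frozenDensity_le_one : |frozenDensity K| ≤ 1 := by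
  rw [frozenDensity, abs_of_nonneg (by positivity)]
  exact div_le_one_of_le₀ (mod_cast Finset.card_le_univ _) (Nat.cast_nonneg _)

theorem abs_lockedDensity_le_one : |lockedDensity K| ≤ 1 := by
  rw [lockedDensity, abs_of_nonneg (by positivity)]
  refine div_le_one_of_le₀ ?_ (by positivity)
  rw [sq]
  exact_mod_cast (Finset.card_le_univ _).trans_eq (Fintype.card_prod κ κ)

end Density

section Binary

theorem eq_one_of_ne_zero {b : ZMod 2} (hb : b ≠ 0) : b = 1 := Fin.eq_one_of_ne_zero b hb

variable {κ : Type*} [Fintype κ] {K : Submodule (ZMod 2) (κ → ZMod 2)} {i j : κ}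

theorem mem_frozenSet_pinned :
    i ∈ frozenSet (pinned K j) ↔ i ∈ frozenSet K ∨ (i, j) ∈ lockedPairs K := by
  simp only [mem_lockedPairs, or_and_left, em, true_and]
  simp only [mem_frozenSet, mem_pinned, and_imp]
  refine ⟨fun h => or_iff_not_imp_left.2 fun hi x hx => ?_, ?_⟩
  · push Not at hi
    obtain ⟨z, hz, hzi⟩ := hi
    have hzj : z j ≠ 0 := fun hzj => hzi (h z hz hzj)
    by_cases hxj : x j = 0
    · rw [hxj, h x hx hxj]
    · have hdiff : x i - z i = 0 := h (x - z) (K.sub_mem hx hz) (by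
        rw [Pi.sub_apply, eq_one_of_ne_zero hxj, eq_one_of_ne_zero hzj, sub_self])
      rw [sub_eq_zero.1 hdiff, eq_one_of_ne_zero hzi, eq_one_of_ne_zero hxj]
  · rintro (h | h) x hx hxj
    · exact h x hx
    · rw [h x hx, hxj]

theorem sum_card_frozenSet_pinned (K : Submodule (ZMod 2) (κ → ZMod 2)) :
    ∑ j, (frozenSet (pinned K j)).card =
      Fintype.card κ * (frozenSet K).card + (lockedPairs K).card := by
  classical
  have hcard (j : κ) : (frozenSet (pinned K j)).card =
      (frozenSet K).card + ∑ i, if (i, j) ∈ lockedPairs K then 1 else 0 := by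
    have hunion : frozenSet (pinned K j) =
        frozenSet K ∪ Finset.univ.filter fun i => (i, j) ∈ lockedPairs K := by
      ext i
      simp [mem_frozenSet_pinned]
    rw [hunion, Finset.card_union_of_disjoint, Finset.card_filter]
    refine Finset.disjoint_left.2 fun i hi hij => ?_
    exact (mem_lockedPairs.1 (Finset.mem_filter.1 hij).2).1 hi
  simp only [hcard, Finset.sum_add_distrib, Finset.sum_const, Finset.card_univ, smul_eq_mul]
  rw [← Fintype.sum_prod_type_right' fun i j => if (i, j) ∈ lockedPairs K then 1 else 0]
  simp

theorem average_frozenDensity_pinned [Nonempty κ] (K : Submodule (ZMod 2) (κ → ZMod 2)) :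
    (∑ j, frozenDensity (pinned K j)) / Fintype.card κ = frozenDensity K + lockedDensity K := by
  have hcount : ∑ j, ((frozenSet (pinned K j)).card : ℝ) =
      Fintype.card κ * (frozenSet K).card + (lockedPairs K).card :=
    mod_cast sum_card_frozenSet_pinned K
  simp only [frozenDensity, lockedDensity, ← Finset.sum_div, hcount]
  field_simp

/-- The nontrivial character of `𝔽₂`, with values `1` at `0` and `-1` at `1`. -/
noncomputable def sign : AddChar (ZMod 2) ℝ := AddChar.zmodChar 2 neg_one_sq

theorem sign_eq_ite (b : ZMod 2) : sign b = if b = 0 then 1 else -1 := by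
  by_cases hb : b = 0
  · simp [hb]
  · rw [if_neg hb, eq_one_of_ne_zero hb, sign, AddChar.zmodChar_apply, ZMod.val_one, pow_one]

open Classical in
theorem sum_sign_comp {G : Type*} [AddGroup G] [Fintype G] (f : G →+ ZMod 2) :
    ∑ y, sign (f y) = if f = 0 then (Fintype.card G : ℝ) else 0 := by
  have htrivial : sign.compAddMonoidHom f = 0 ↔ f = 0 := by
    rw [AddChar.eq_zero_iff, DFunLike.ext_iff]
    refine forall_congr' fun y => ?_
    rw [AddChar.compAddMonoidHom_apply, sign_eq_ite, AddMonoidHom.zero_apply]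
    split_ifs with h <;> norm_num [h]
  simpa [htrivial] using AddChar.sum_eq_ite (sign.compAddMonoidHom f)

open Classical in
theorem sum_sign_mul_sign [Fintype K] (hi : i ∉ frozenSet K) :
    ∑ y : K, sign (y.1 i) * sign (y.1 j) =
      if (i, j) ∈ lockedPairs K then (Fintype.card K : ℝ) else 0 := by
  let diff : K →+ ZMod 2 :=
    AddMonoidHom.mk' (fun y => y.1 i - y.1 j) fun _ _ => add_sub_add_comm _ _ _ _
  have hdiff : diff = 0 ↔ (i, j) ∈ lockedPairs K := by
    rw [mem_lockedPairs, DFunLike.ext_iff]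
    simp [diff, hi, sub_eq_zero]
  have hprod (y : K) : sign (y.1 i) * sign (y.1 j) = sign (diff y) := by
    rw [← AddChar.map_add_eq_mul, ← CharTwo.sub_eq_add]
    rfl
  simp only [hprod, sum_sign_comp, hdiff]

open Classical in
theorem card_zeros_sub_eq_sum_sign {y : κ → ZMod 2} (hy : y ∈ K) :
    (∑ i, if y i = 0 then (1 : ℝ) else 0) - (Fintype.card κ + (frozenSet K).card) / 2 =
      (∑ i ∈ (frozenSet K)ᶜ, sign (y i)) / 2 := by
  have hzero (i : κ) : (if y i = 0 then (1 : ℝ) else 0) = (1 + sign (y i)) / 2 := by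
    rw [sign_eq_ite]
    split_ifs <;> norm_num
  have hfrozen : ∑ i ∈ frozenSet K, sign (y i) = (frozenSet K).card := by
    rw [Finset.sum_congr rfl fun i hi => by
      rw [mem_frozenSet.1 hi y hy, AddChar.map_zero_eq_one]]
    simp
  rw [Finset.sum_congr rfl fun i _ => hzero i, ← Finset.sum_div, Finset.sum_add_distrib,
    ← Finset.sum_add_sum_compl (frozenSet K) fun i => sign (y i), hfrozen]
  simp only [Finset.sum_const, Finset.card_univ, nsmul_eq_mul]
  ring

theorem sum_sq_card_zeros_sub (K : Submodule (ZMod 2) (κ → ZMod 2)) [Fintype K] :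
    ∑ y : K, ((∑ i, if y.1 i = 0 then (1 : ℝ) else 0) -
        (Fintype.card κ + (frozenSet K).card) / 2) ^ 2 =
      Fintype.card K * (((lockedPairs K).card : ℝ) / 4) := by
  classical
  set U := (frozenSet K)ᶜ with hU
  have hlocked : lockedPairs K ⊆ U ×ˢ U := fun ⟨i, j⟩ hij => by
    simpa [hU] using ⟨(mem_lockedPairs.1 hij).1, snd_notMem_frozenSet_of_mem_lockedPairs hij⟩
  calc _ = ∑ y : K, (∑ p ∈ U ×ˢ U, sign (y.1 p.1) * sign (y.1 p.2)) / 4 := by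
        refine Finset.sum_congr rfl fun y _ => ?_
        rw [card_zeros_sub_eq_sum_sign y.2, div_pow, sq (∑ i ∈ _, _), Finset.sum_mul_sum,
          ← Finset.sum_product', hU]
        norm_num
    _ = (∑ p ∈ U ×ˢ U, ∑ y : K, sign (y.1 p.1) * sign (y.1 p.2)) / 4 := by
        rw [← Finset.sum_div, Finset.sum_comm]
    _ = (∑ p ∈ U ×ˢ U, if p ∈ lockedPairs K then (Fintype.card K : ℝ) else 0) / 4 := by
        congr 1
        refine Finset.sum_congr rfl fun p hp => sum_sign_mul_sign ?_
        exact Finset.mem_compl.1 (Finset.mem_product.1 hp).1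
    _ = Fintype.card K * (((lockedPairs K).card : ℝ) / 4) := by
        rw [Finset.sum_ite_mem, Finset.inter_eq_right.2 hlocked, Finset.sum_const, nsmul_eq_mul]
        ring

end Binary

/-- All events about a single entry are measurable. -/
local instance instMeasurableSpaceZModTwo : MeasurableSpace (ZMod 2) := ⊤

section Planting

variable {R ι κ : Type*} [DecidableEq κ]

theorem pi_single_one_injective [Zero R] [One R] [NeZero (1 : R)] :
    Function.Injective fun j : κ => (Pi.single j 1 : κ → R) := fun i j hij => by
  by_contra hne
  simpa [Pi.single_eq_of_ne hne] using congrFun hij i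

variable [Fintype κ]

theorem ker_mulVecLin_updateRow_single [CommRing R] [DecidableEq ι] (A : Matrix ι κ R) (r : ι)
    (j : κ) :
    LinearMap.ker (A.updateRow r (Pi.single j 1)).mulVecLin =
      pinned (LinearMap.ker (A.updateRow r 0).mulVecLin) j := by
  have hrow (v x : κ → R) : x ∈ LinearMap.ker (A.updateRow r v).mulVecLin ↔
      v ⬝ᵥ x = 0 ∧ ∀ s, s ≠ r → A.mulVec x s = 0 := by
    rw [LinearMap.mem_ker, Matrix.mulVecLin_apply, Matrix.updateRow_mulVec, funext_iff,
      Function.forall_update_iff _ fun s b => b = (0 : ι → R) s]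
    rfl
  ext x
  rw [mem_pinned, hrow, hrow, single_one_dotProduct, zero_dotProduct]
  simp [and_comm]

open MeasureTheory

theorem integral_lockedDensity_le [Fintype ι] [Nonempty ι] [Nonempty κ]
    (μ : Measure (κ → ZMod 2)) [IsProbabilityMeasure μ] (hzero : 0 < μ.real {0}) {b : ℝ}
    (hb : 0 < b) (hunit : ∀ j, μ.real {Pi.single j 1} = b) :
    ∫ A : ι → κ → ZMod 2, lockedDensity (LinearMap.ker (Matrix.of A).mulVecLin)
        ∂Measure.pi (fun _ => μ) ≤
      2 / √(Fintype.card ι * μ.real {0}) + 1 / √(Fintype.card ι * (Fintype.card κ * b)) := by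
  classical
  let φ (A : ι → κ → ZMod 2) : ℝ := frozenDensity (LinearMap.ker (Matrix.of A).mulVecLin)
  let ψ (A : ι → κ → ZMod 2) : ℝ := lockedDensity (LinearMap.ker (Matrix.of A).mulVecLin)
  have hpin (A : ι → κ → ZMod 2) (r : ι) :
      (∑ j, φ (Function.update A r (Pi.single j 1))) / Fintype.card κ =
        φ (Function.update A r 0) + ψ (Function.update A r 0) := by
    have hker (j : κ) :
        LinearMap.ker (Matrix.of (Function.update A r (Pi.single j 1))).mulVecLin =
          pinned (LinearMap.ker (Matrix.of (Function.update A r 0)).mulVecLin) j :=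
      ker_mulVecLin_updateRow_single (Matrix.of A) r j
    simp only [φ, ψ, hker, average_frozenDensity_pinned]
  have hφ0 := abs_integral_sub_average_update_le (ι := ι) μ hzero
    (G := φ) .of_discrete fun A => abs_frozenDensity_le_one _
  have hψ0 := abs_integral_sub_average_update_le (ι := ι) μ hzero
    (G := ψ) .of_discrete fun A => abs_lockedDensity_le_one _
  have hφ1 := abs_integral_sub_average_update_range_le (ι := ι) μ pi_single_one_injective hb hunit
    (G := φ) .of_discrete fun A => abs_frozenDensity_le_one _
  simp only [hpin, integral_add .of_finite .of_finite, Finset.sum_add_distrib, add_div] at hφ1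
  change ∫ A, ψ A ∂_ ≤ _
  rw [div_eq_mul_one_div 2]
  linarith [(abs_le.1 hφ0).2, (abs_le.1 hψ0).2, (abs_le.1 hφ1).1]

end Planting

section Laws

open MeasureTheory

variable {p : ℝ≥0}

theorem toReal_entryWeight_zero (hp : p ≤ 1) : (entryWeight p 0).toReal = 1 - p := by
  rw [entryWeight, if_neg zero_ne_one, ENNReal.coe_toReal, NNReal.coe_sub hp, NNReal.coe_one]

theorem toReal_entryWeight_one : (entryWeight p 1).toReal = p := by
  rw [entryWeight, if_pos rfl, ENNReal.coe_toReal]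

variable (hp : p ≤ 1) {κ : Type*} [Fintype κ]

/-- The law of a single entry of the random matrix. -/
noncomputable def entryLaw : PMF (ZMod 2) := PMF.ofFintype (entryWeight p) (sum_entryWeight hp)

/-- The law of a row of the random matrix. -/
noncomputable abbrev rowLaw (κ : Type*) [Fintype κ] : Measure (κ → ZMod 2) :=
  Measure.pi fun _ => (entryLaw hp).toMeasure

theorem rowLaw_singleton (v : κ → ZMod 2) :
    rowLaw hp κ {v} = ∏ j, entryWeight p (v j) := by
  rw [Measure.pi_singleton]
  exact Finset.prod_congr rfl fun j _ => PMF.toMeasure_apply_singleton _ _ (.singleton _)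

theorem measureReal_rowLaw_zero : (rowLaw hp κ).real {0} = (1 - p) ^ Fintype.card κ := by
  rw [measureReal_def, rowLaw_singleton, ENNReal.toReal_prod]
  simp [toReal_entryWeight_zero hp]

theorem measureReal_rowLaw_single [DecidableEq κ] (j : κ) :
    (rowLaw hp κ).real {Pi.single j 1} = p * (1 - p) ^ (Fintype.card κ - 1) := by
  rw [measureReal_def, rowLaw_singleton, ENNReal.toReal_prod,
    Fintype.prod_eq_mul_prod_compl j, Pi.single_eq_same, toReal_entryWeight_one,
    ← Finset.card_singleton j, ← Finset.card_compl]
  congr 1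
  refine Finset.prod_eq_pow_card fun k hk => ?_
  rw [Pi.single_eq_of_ne (by simpa using hk), toReal_entryWeight_zero hp]

theorem entryProb_le_one (d : ℝ) (n : ℕ) : entryProb d n ≤ 1 := min_le_right _ _

theorem expectation_matrixLaw (d : ℝ) (n : ℕ) (F : Matrix (Fin n) (Fin n) (ZMod 2) → ℝ) :
    expectation (matrixLaw d n) F =
      ∫ A, F (Matrix.of A) ∂Measure.pi fun _ => rowLaw (entryProb_le_one d n) (Fin n) := by
  have hmass (A : Fin n → Fin n → ZMod 2) :
      (Measure.pi fun _ => rowLaw (entryProb_le_one d n) (Fin n)).real {A} =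
        (matrixLaw d n (Matrix.of A)).toReal := by
    rw [measureReal_def, Measure.pi_singleton]
    simp only [rowLaw_singleton]
    rfl
  rw [integral_fintype .of_finite]
  simp only [hmass]
  rfl

end Laws

section Expectation

variable {Ω Ω' : Type*} [Fintype Ω] [Fintype Ω']

theorem expectation_pure (a : Ω) (X : Ω → ℝ) : expectation (PMF.pure a) X = X a := by
  classical
  simp [expectation, PMF.pure_apply, apply_ite ENNReal.toReal]

theorem expectation_bind (μ : PMF Ω) (f : Ω → PMF Ω') (X : Ω' → ℝ) :
    expectation (μ.bind f) X = expectation μ fun a => expectation (f a) X := by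
  have hmass (ω : Ω') : (μ.bind f ω).toReal = ∑ a, (μ a).toReal * (f a ω).toReal := by
    rw [PMF.bind_apply, tsum_fintype, ENNReal.toReal_sum fun a _ =>
      ENNReal.mul_ne_top (μ.apply_ne_top a) ((f a).apply_ne_top ω)]
    simp only [ENNReal.toReal_mul]
  simp only [expectation, hmass, Finset.sum_mul, Finset.mul_sum, mul_assoc]
  exact Finset.sum_comm

theorem expectation_uniformOfFintype [Nonempty Ω] (X : Ω → ℝ) :
    expectation (PMF.uniformOfFintype Ω) X = (∑ ω, X ω) / Fintype.card Ω := by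
  simp [expectation, inv_mul_eq_div, Finset.sum_div]

theorem expectation_map (μ : PMF Ω) (f : Ω → Ω') (X : Ω' → ℝ) :
    expectation (μ.map f) X = expectation μ (X ∘ f) := by
  simp only [PMF.map, expectation_bind, Function.comp_def, expectation_pure]

open MeasureTheory in
theorem expectation_abs_le_sqrt_expectation_sq (μ : PMF Ω) (X : Ω → ℝ) :
    expectation μ (fun ω => |X ω|) ≤ √(expectation μ fun ω => X ω ^ 2) := by
  let _ : MeasurableSpace Ω := ⊤
  simpa only [expectation, PMF.integral_eq_sum, smul_eq_mul] using
    integral_abs_le_sqrt_integral_sq (P := μ.toMeasure) (X := X) .of_discrete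

theorem expectation_jointLaw (d : ℝ) (n : ℕ)
    (X : Matrix (Fin n) (Fin n) (ZMod 2) × (Fin n → ZMod 2) × (Fin n → ZMod 2) → ℝ) :
    expectation (jointLaw d n) X = expectation (matrixLaw d n) fun A =>
      expectation (uniformKernel A) fun x => expectation (uniformKernel A) fun x' =>
        X (A, x, x') := by
  simp only [jointLaw, expectation_bind, expectation_pure]

open Classical in
theorem expectation_uniformKernel {n : ℕ} (A : Matrix (Fin n) (Fin n) (ZMod 2))
    (X : (Fin n → ZMod 2) → ℝ) :
    expectation (uniformKernel A) X = (∑ x : kernel A, X x) / Fintype.card (kernel A) := by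
  rw [uniformKernel, expectation_map, expectation_uniformOfFintype]
  rfl

theorem expectation_uniformKernel_sub {n : ℕ} (A : Matrix (Fin n) (Fin n) (ZMod 2))
    (X : (Fin n → ZMod 2) → ℝ) :
    (expectation (uniformKernel A) fun x => expectation (uniformKernel A) fun x' => X (x - x')) =
      expectation (uniformKernel A) X := by
  classical
  have hshift (x : kernel A) : ∑ x' : kernel A, X (x - x') = ∑ y : kernel A, X y :=
    Equiv.sum_comp (Equiv.subLeft x) fun y : kernel A => X y
  have hcard : (Fintype.card (kernel A) : ℝ) ≠ 0 := mod_cast Fintype.card_ne_zero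
  simp only [expectation_uniformKernel, ← Finset.sum_div, hshift, Finset.sum_const,
    Finset.card_univ, nsmul_eq_mul]
  rw [mul_div_cancel_left₀ _ hcard]

end Expectation

section Overlap

variable {n : ℕ}

theorem frozenFraction_eq_frozenDensity (A : Matrix (Fin n) (Fin n) (ZMod 2)) :
    frozenFraction A = frozenDensity (kernel A) := by
  rw [frozenFraction, frozenDensity, ← Set.ncard_coe_finset, Fintype.card_fin]
  congr 3 with i
  simp [mem_frozenSet]

theorem overlap_sub_eq [NeZero n] (A : Matrix (Fin n) (Fin n) (ZMod 2)) (x x' : Fin n → ZMod 2) :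
    overlap x x' - (1 + frozenFraction A) / 2 =
      ((∑ i, if (x - x') i = 0 then (1 : ℝ) else 0) -
        (Fintype.card (Fin n) + (frozenSet (kernel A)).card) / 2) / n := by
  have hn : (n : ℝ) ≠ 0 := mod_cast NeZero.ne n
  simp only [overlap, frozenFraction_eq_frozenDensity, frozenDensity, Pi.sub_apply, sub_eq_zero,
    Fintype.card_fin]
  field_simp

theorem expectation_sq_overlap_sub [NeZero n] (A : Matrix (Fin n) (Fin n) (ZMod 2)) :
    (expectation (uniformKernel A) fun x => expectation (uniformKernel A) fun x' =>
      (overlap x x' - (1 + frozenFraction A) / 2) ^ 2) = lockedDensity (kernel A) / 4 := by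
  classical
  simp only [overlap_sub_eq, div_pow]
  rw [expectation_uniformKernel_sub A fun y => ((∑ i, if y i = 0 then (1 : ℝ) else 0) -
    (Fintype.card (Fin n) + (frozenSet (kernel A)).card) / 2) ^ 2 / (n : ℝ) ^ 2,
    expectation_uniformKernel, ← Finset.sum_div, sum_sq_card_zeros_sub, lockedDensity,
    Fintype.card_fin]
  have hcard : (Fintype.card (kernel A) : ℝ) ≠ 0 := mod_cast Fintype.card_ne_zero
  field_simp

theorem expectation_abs_overlap_sub_le [NeZero n] (d : ℝ) :
    expectation (jointLaw d n) (fun ω => |overlap ω.2.1 ω.2.2 - (1 + frozenFraction ω.1) / 2|) ≤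
      √(expectation (matrixLaw d n) (fun A => lockedDensity (kernel A)) / 4) := by
  refine (expectation_abs_le_sqrt_expectation_sq _ _).trans_eq ?_
  simp only [expectation_jointLaw, expectation_sq_overlap_sub]
  simp only [expectation, ← mul_div_assoc, Finset.sum_div]

end Overlap

section Asymptotics

open Filter Topology

variable {d : ℝ} {n : ℕ}

theorem coe_entryProb (hd : 0 < d) (hn : d < n) : (entryProb d n : ℝ) = d / n := by
  have hn0 : 0 < (n : ℝ) := hd.trans hn
  rw [entryProb, NNReal.coe_min, Real.coe_toNNReal _ (by positivity), NNReal.coe_one]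
  exact min_eq_left ((div_le_one hn0).2 hn.le)

theorem expectation_lockedDensity_le (hd : 0 < d) (hn : d < n) :
    expectation (matrixLaw d n) (fun A => lockedDensity (kernel A)) ≤
      2 / √(n * (1 - d / n) ^ n) + 1 / √(d * (n * (1 - d / n) ^ n)) := by
  have hn0 : 0 < (n : ℝ) := hd.trans hn
  have : NeZero n := ⟨by rintro rfl; exact hn0.ne' Nat.cast_zero⟩
  have hp := coe_entryProb hd hn
  have hp0 : 0 < d / n := by positivity
  have hq : 0 < 1 - d / n := sub_pos.2 ((div_lt_one hn0).2 hn)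
  have hzero := measureReal_rowLaw_zero (κ := Fin n) (entryProb_le_one d n)
  have hunit := measureReal_rowLaw_single (κ := Fin n) (entryProb_le_one d n)
  rw [hp, Fintype.card_fin] at hzero
  simp only [hp, Fintype.card_fin] at hunit
  have hrare : d * (n * (1 - d / n) ^ n) ≤ n * (n * (d / n * (1 - d / n) ^ (n - 1))) :=
    calc d * (n * (1 - d / n) ^ n) ≤ d * (n * (1 - d / n) ^ (n - 1)) := by
          gcongr ?_ * (_ * ?_)
          exact pow_le_pow_of_le_one hq.le (by linarith) (Nat.sub_le n 1)
      _ = n * (n * (d / n * (1 - d / n) ^ (n - 1))) := by field_simp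
  rw [expectation_matrixLaw]
  refine (integral_lockedDensity_le _ (hzero ▸ by positivity) (by positivity) hunit).trans ?_
  rw [Fintype.card_fin, hzero]
  gcongr

theorem tendsto_natCast_mul_one_sub_div_pow (d : ℝ) :
    Tendsto (fun n : ℕ => (n : ℝ) * (1 - d / n) ^ n) atTop atTop := by
  have hexp := Real.tendsto_one_add_div_pow_exp (-d)
  simp only [neg_div, ← sub_eq_add_neg] at hexp
  exact tendsto_natCast_atTop_atTop.atTop_mul_pos (Real.exp_pos _) hexp

theorem tendsto_expectation_lockedDensity (hd : 0 < d) :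
    Tendsto (fun n : ℕ => expectation (matrixLaw d n) fun A => lockedDensity (kernel A)) atTop
      (𝓝 0) := by
  have hzero := tendsto_natCast_mul_one_sub_div_pow d
  have hunit := hzero.const_mul_atTop hd
  have hbound := ((Real.tendsto_sqrt_atTop.comp hzero).const_div_atTop 2).add
    ((Real.tendsto_sqrt_atTop.comp hunit).const_div_atTop 1)
  rw [add_zero] at hbound
  refine squeeze_zero' (.of_forall fun n => Finset.sum_nonneg fun A _ =>
    mul_nonneg ENNReal.toReal_nonneg ?_) ?_ hbound
  · exact div_nonneg (Nat.cast_nonneg _) (sq_nonneg _)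
  · filter_upwards [tendsto_natCast_atTop_atTop.eventually_gt_atTop d] with n hn
    exact expectation_lockedDensity_le hd hn

end Asymptotics

end SparseParity

open SparseParity Filter in
theorem corollary2p12 (d : ℝ) (hd : 0 < d) :
    Filter.Tendsto
      (fun n : ℕ => SparseParity.expectation (SparseParity.jointLaw d n) fun ω =>
        |SparseParity.overlap ω.2.1 ω.2.2 - (1 + SparseParity.frozenFraction ω.1) / 2|)
      Filter.atTop (nhds 0) := by
  have hlocked := ((tendsto_expectation_lockedDensity hd).div_const 4).sqrt
  rw [zero_div, Real.sqrt_zero] at hlocked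
  refine squeeze_zero' (.of_forall fun n => Finset.sum_nonneg fun ω _ =>
    mul_nonneg ENNReal.toReal_nonneg (abs_nonneg _)) ?_ hlocked
  filter_upwards [eventually_ne_atTop 0] with n hn
  have : NeZero n := ⟨hn⟩
  exact expectation_abs_overlap_sub_le d
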